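/- **Setting.** Let $\rho$ be a probability measure on $\mathcal X\times\mathbb R$ ($\mathcal X$ a measurable space) with first marginal $\nu$, let $\mathcal H_1$ be a real separable Hilbert space, and let $A:\mathcal H_1\to L^2(\mathcal X,\nu)$ be a bounded linear operator of the form $(Af)(x)=\langle f,\phi_x\rangle$ for $\nu$-almost every $x$, where $\phi_x\in\mathcal H_1$ and, for some constant $c$, $|\langle f,\phi_x\rangle|\le c\|f\|$ for all $x\in\mathcal X$, $f\in\mathcal H_1$. Put $B=A^*A$; it is a compact positive operator, and $h(B)$ denotes the functional calculus of $B$. Let $(X_1,Y_1),\dots,(X_n,Y_n)$ be i.i.d. with law $\rho$ and write $\mathbb E$ for the expectation with respect to $\rho^{\otimes n}$. Assume that for $\nu$-almost every $x$ the conditional law of $Y$ given $X=x$ has finite second moment and $$\mathbb E(Y\mid X=x)=(Af^\dagger)(x),\qquad \mathrm{Var}(Y\mid X=x)=\sigma^2,$$ with $f^\dagger\in\mathcal H_1$ and a constant $\sigma$. Let $(s_\lambda)_{\lambda>0}$ be real functions on the spectrum $\sigma(B)$ for which there are constants $D,E,q>0$ and $C_p>0$ $(0\le p\le q)$ such that for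 all $\lambda>0$ and all $t\in\sigma(B)$ $$|t\,s_\lambda(t)|\le D,\qquad |\lambda\, s_\lambda(t)|\le E,\qquad |t^{p}(1-t\,s_\lambda(t))|\le C_{p}\lambda^{p}\quad(0\le p\le q).$$ Define the estimator $$\hat f_n^\lambda=s_\lambda(A^*A)A_{\mathbf x}^*\mathbf y,\qquad A_{\mathbf x}^*\mathbf y=\frac1n\sum_{j=1}^nY_j\phi_{X_j}.$$ **Lemma.** Assume the source condition $f^\dagger=B^rw$ with $\|w\|\le R$, where $0<r\le q$ and $R>0$, and the eigenvalue decay $\mu_j\le d\,j^{-b}$ for all $j\ge1$, where $d>0$, $b>1$ and $(\mu_j)_{j\ge1}$ lists the nonzero eigenvalues of $B$ with multiplicity (entries $\mu_j=0$ being allowed). Let $\lambda=\lambda_n>0$ with $\lambda_n=\Theta\big(n^{-1/(2r+1+1/b)}\big)$ as $n\to\infty$. Then $\mathbb E\|\hat f_n^{\lambda_n}-f^\dagger\|^2$ is finite for every $n$ and $$\mathbb E\big\|\hat f_n^{\lambda_n}-f^\dagger\big\|^2=O\Big(n^{-\frac{2r}{2r+1+1/b}}\Big)\qquad(n\to\infty).$$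 -/

import Mathlib

open MeasureTheory ProbabilityTheory Filter Asymptotics

noncomputable section

namespace SpectralRate

/-- The eigenspace `{v | T v = t v}` of a bounded operator (trivial when `t` is not an
eigenvalue). -/
abbrev eigSpace {H : Type*} [NormedAddCommGroup H] [InnerProductSpace ℝ H]
    (T : H →L[ℝ] H) (t : ℝ) : Submodule ℝ H :=
  Module.End.eigenspace (T : H →ₗ[ℝ] H) t

instance eigSpace_complete {H : Type*} [NormedAddCommGroup H] [InnerProductSpace ℝ H]
    [CompleteSpace H] (T : H →L[ℝ] H) (t : ℝ) : CompleteSpace (eigSpace T t) := by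
  have h : IsClosed {v : H | T v = t • v} :=
    isClosed_eq T.continuous (continuous_const_smul t)
  have h' : ((eigSpace T t : Submodule ℝ H) : Set H) = {v : H | T v = t • v} := by
    ext v
    simp [eigSpace, Module.End.mem_eigenspace_iff]
  exact IsClosed.completeSpace_coe (hs := h' ▸ h)

/-- Functional calculus `h(T)` of a compact self-adjoint operator `T`: the spectral sum
`h(T) v = ∑ h(t) P_t v` over the eigenvalues `t` of `T` (zero included), where `P_t` is the
orthogonal projection onto the eigenspace of `t`, so `P_t = 0` when `t` is not an eigenvalue.
The sum converges unconditionally for every `h` that is bounded on the spectrum of `T`. -/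
def spectralFun {H : Type*} [NormedAddCommGroup H] [InnerProductSpace ℝ H] [CompleteSpace H]
    (h : ℝ → ℝ) (T : H →L[ℝ] H) (v : H) : H :=
  ∑' t : ℝ, h t • (eigSpace T t).starProjection v

/-- `ev` lists the nonzero eigenvalues of `T`, each repeated according to its multiplicity;
entries equal to zero may occur, in particular when `T` has finite rank. -/
def IsEigenvalueList {H : Type*} [NormedAddCommGroup H] [InnerProductSpace ℝ H]
    (T : H →L[ℝ] H) (ev : ℕ → ℝ) : Prop :=
  ∀ t : ℝ, t ≠ 0 → {j | ev j = t}.encard = Cardinal.toENat (Module.rank ℝ (eigSpace T t))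

/-- The source set `ω(r, R) = {T^r w : ‖w‖ ≤ R}`. -/
def sourceSet {H : Type*} [NormedAddCommGroup H] [InnerProductSpace ℝ H] [CompleteSpace H]
    (T : H →L[ℝ] H) (r R : ℝ) : Set H :=
  {f | ∃ w : H, ‖w‖ ≤ R ∧ f = spectralFun (fun t => t ^ r) T w}

/-- `s = (s_l)_{l > 0}` is a family of regularization (filter) functions on the spectrum of `T`
with qualification `q`. -/
structure IsFilterFamily {H : Type*} [NormedAddCommGroup H] [InnerProductSpace ℝ H]
    (T : H →L[ℝ] H) (s : ℝ → ℝ → ℝ) (q : ℝ) : Prop where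
  qualification_pos : 0 < q
  bound_mul : ∃ D > 0, ∀ l > 0, ∀ t ∈ spectrum ℝ T, |t * s l t| ≤ D
  bound_param : ∃ E > 0, ∀ l > 0, ∀ t ∈ spectrum ℝ T, |l * s l t| ≤ E
  qualification : ∀ p : ℝ, 0 ≤ p → p ≤ q → ∃ C > 0, ∀ l > 0, ∀ t ∈ spectrum ℝ T,
    |t ^ p * (1 - t * s l t)| ≤ C * l ^ p

/-- The sampling model: under `ρ`, the conditional law of `Y` given `X = x` has finite second
moment, mean `y x` and variance `σ ^ 2`, for almost every `x` with respect to the law of `X`. -/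
structure IsSamplingModel {X : Type*} [MeasurableSpace X] (ρ : Measure (X × ℝ))
    [IsFiniteMeasure ρ] (y : X → ℝ) (σ : ℝ) : Prop where
  memLp_two : ∀ᵐ x ∂ρ.fst, MemLp (fun u : ℝ => u) 2 (ρ.condKernel x)
  cond_mean : ∀ᵐ x ∂ρ.fst, ∫ u, u ∂(ρ.condKernel x) = y x
  cond_variance : ∀ᵐ x ∂ρ.fst, variance (fun u : ℝ => u) (ρ.condKernel x) = σ ^ 2

/-- `A_x^* y = (1/n) ∑ Y_j φ_{X_j}` for the sample `z = ((X_1, Y_1), …, (X_n, Y_n))`: the adjoint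
of `f ↦ (⟨f, φ_{X_j}⟩)_j` when `ℝ^n` carries the inner product `(1/n) ∑ a_j b_j`. -/
def sampleAdjoint {X H : Type*} [NormedAddCommGroup H] [InnerProductSpace ℝ H]
    (φ : X → H) {n : ℕ} (z : Fin n → X × ℝ) : H :=
  (1 / (n : ℝ)) • ∑ j, (z j).2 • φ (z j).1

/-- The estimator `s_l(B) A_x^* y`, with `B = A^* A` the population operator. -/
def estimator {X H : Type*} [NormedAddCommGroup H] [InnerProductSpace ℝ H] [CompleteSpace H]
    (B : H →L[ℝ] H) (s : ℝ → ℝ → ℝ) (φ : X → H) (l : ℝ) {n : ℕ} (z : Fin n → X × ℝ) : H :=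
  spectralFun (s l) B (sampleAdjoint φ z)

/-- `B = A^* A`. -/
def normalOp {H K : Type*} [NormedAddCommGroup H] [InnerProductSpace ℝ H] [CompleteSpace H]
    [NormedAddCommGroup K] [InnerProductSpace ℝ K] [CompleteSpace K] (A : H →L[ℝ] K) :
    H →L[ℝ] H :=
  (ContinuousLinearMap.adjoint A).comp A

end SpectralRate

end

/-! The estimator is linear in the data: it is the mean of `n` independent copies of `Z = s_l(B)(Y
φ_X)`. Since `E(Y φ_X) = B f†`, its expectation is `s_l(B) B f†`, and the risk is at most twice the
squared bias plus twice `E‖Z‖² / n`.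

Bias (`exists_norm_residual_le`): `f† = B^r w` turns the residual into `-h(B) w` with `h(t) = t^r (1
- t s_l(t))`, and the qualification with `p = r` bounds it by a multiple of `l^r`. As `f†` is itself
a spectral sum over eigenvectors, completeness of the eigenvectors never enters.

Variance (`exists_lintegral_filter_le`): conditioning on `X` replaces `Y²` by at most `σ² +
(c‖f†‖)²`. Because `E⟨f, φ_X⟩² = ⟨f, B f⟩`, what remains, `E‖s_l(B) φ_X‖²`, is at most `∑ s_l(μ_j)²
μ_j`. The filter bounds control each term both by `1/l` and by `j^{-b}/l²`, up to constants;
comparison with an integral makes the sum `O(l^{-(1+1/b)})`.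

The risk is thus `O(l^{-(1+1/b)}/n + l^{2r})`, and the prescribed `l` makes the two orders equal. -/

namespace SpectralRate

open scoped ENNReal InnerProductSpace

/-! ### Orthonormal families and eigenspaces -/

section Hilbert

variable {H : Type*} [NormedAddCommGroup H] [InnerProductSpace ℝ H]

/-- An orthonormal family in a separable space is countable. -/
theorem countable_of_orthonormal [TopologicalSpace.SeparableSpace H] {ι : Type*} {v : ι → H}
    (hv : Orthonormal ℝ v) : Countable ι := by
  rw [← Set.countable_univ_iff]
  -- Distinct members lie at distance `√2 > 1`, so balls of radius `1/2` around them are disjoint.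
  refine Set.PairwiseDisjoint.countable_of_isOpen (s := fun i => Metric.ball (v i) (1 / 2)) ?_
    (fun _ _ => Metric.isOpen_ball) (fun i _ => ⟨v i, by simp⟩)
  intro i _ j _ hij
  refine Metric.ball_disjoint_ball ?_
  have h : dist (v i) (v j) ^ 2 = 2 := by
    rw [dist_eq_norm, @norm_sub_sq_real, hv.1 i, hv.1 j, hv.2 hij]
    norm_num
  nlinarith [dist_nonneg (x := v i) (y := v j)]

theorem enorm_sq_eq_ofReal {E : Type*} [NormedAddCommGroup E] (x : E) :
    ‖x‖ₑ ^ 2 = ENNReal.ofReal (‖x‖ ^ 2) := by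
  rw [ENNReal.ofReal_pow (norm_nonneg x), ofReal_norm]

/-- Parseval's identity in `ℝ≥0∞`. -/
theorem enorm_sq_eq_tsum {ι : Type*} (b : HilbertBasis ι ℝ H) (x : H) :
    ‖x‖ₑ ^ 2 = ∑' i, ‖⟪b i, x⟫_ℝ‖ₑ ^ 2 := by
  have h := b.hasSum_inner_mul_inner x x
  have h' : (fun i => ⟪x, b i⟫_ℝ * ⟪b i, x⟫_ℝ) = fun i => ‖⟪b i, x⟫_ℝ‖ ^ 2 := by
    ext i
    rw [real_inner_comm, Real.norm_eq_abs, sq_abs, sq]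
  rw [h', real_inner_self_eq_norm_sq] at h
  rw [enorm_sq_eq_ofReal, ← h.tsum_eq,
    ENNReal.ofReal_tsum_of_nonneg (fun _ => sq_nonneg _) h.summable]
  simp_rw [enorm_sq_eq_ofReal]

theorem mem_eigSpace_iff {T : H →L[ℝ] H} {t : ℝ} {v : H} : v ∈ eigSpace T t ↔ T v = t • v := by
  simp [eigSpace]

/-- The filter bounds hold on the spectrum, while spectral sums see only eigenvalues; this transfers
the former to the latter. -/
theorem eigSpace_ne_bot_mem_spectrum {T : H →L[ℝ] H} {t : ℝ} (h : eigSpace T t ≠ ⊥) :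
    t ∈ spectrum ℝ T := by
  obtain ⟨v, hv, hv0⟩ := (Submodule.ne_bot_iff _).1 h
  rw [mem_eigSpace_iff] at hv
  rw [spectrum.mem_iff]
  rintro ⟨u, hu⟩
  apply hv0
  have h1 : (u : H →L[ℝ] H) v = 0 := by
    rw [hu]
    simp [hv, Algebra.algebraMap_eq_smul_one]
  calc v = ((↑u⁻¹ : H →L[ℝ] H) * (u : H →L[ℝ] H)) v := by simp
    _ = (↑u⁻¹ : H →L[ℝ] H) ((u : H →L[ℝ] H) v) := rfl
    _ = 0 := by rw [h1, map_zero]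

theorem abs_le_opNorm_of_eigSpace_ne_bot {T : H →L[ℝ] H} {t : ℝ} (h : eigSpace T t ≠ ⊥) :
    |t| ≤ ‖T‖ := by
  obtain ⟨v, hv, hv0⟩ := (Submodule.ne_bot_iff _).1 h
  rw [mem_eigSpace_iff] at hv
  have h1 := T.le_opNorm v
  rw [hv, norm_smul, Real.norm_eq_abs] at h1
  exact le_of_mul_le_mul_right h1 (norm_pos_iff.2 hv0)

end Hilbert

/-! ### Functional calculus by spectral sums -/

section Spectral

variable {H : Type*} [NormedAddCommGroup H] [InnerProductSpace ℝ H] [CompleteSpace H]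
  {T : H →L[ℝ] H}

theorem starProjection_eq_zero_of_eq_bot {t : ℝ} (h : eigSpace T t = ⊥) (v : H) :
    (eigSpace T t).starProjection v = 0 := by
  exact (Submodule.eq_bot_iff _).1 h _ ((eigSpace T t).starProjection_apply_mem v)

theorem sq_mul_norm_sq_le {h : ℝ → ℝ} {M : ℝ} (hM : ∀ t, eigSpace T t ≠ ⊥ → |h t| ≤ M)
    (v : H) (t : ℝ) : h t ^ 2 * ‖(eigSpace T t).starProjection v‖ ^ 2
      ≤ M ^ 2 * ‖(eigSpace T t).starProjection v‖ ^ 2 := by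
  by_cases ht : eigSpace T t = ⊥
  · simp [starProjection_eq_zero_of_eq_bot ht]
  · have := hM t ht
    gcongr ?_ * _
    exact sq_le_sq' (by linarith [neg_abs_le (h t)]) (by linarith [le_abs_self (h t)])

theorem norm_sq_sum_starProjection
    (hT : (T : H →ₗ[ℝ] H).IsSymmetric) (h : ℝ → ℝ) (v : H) (F : Finset ℝ) :
    ‖∑ t ∈ F, h t • (eigSpace T t).starProjection v‖ ^ 2
      = ∑ t ∈ F, h t ^ 2 * ‖(eigSpace T t).starProjection v‖ ^ 2 := by
  have := hT.orthogonalFamily_eigenspaces.norm_sum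
    (fun t => h t • ⟨(eigSpace T t).starProjection v, (eigSpace T t).starProjection_apply_mem v⟩) F
  simpa [norm_smul, mul_pow] using this

/-- Bessel's inequality: with `S` the sum of the projections, `‖S‖² = ⟪S, v⟫ ≤ ‖S‖ ‖v‖`. -/
theorem sum_norm_sq_starProjection_le
    (hT : (T : H →ₗ[ℝ] H).IsSymmetric) (v : H) (F : Finset ℝ) :
    ∑ t ∈ F, ‖(eigSpace T t).starProjection v‖ ^ 2 ≤ ‖v‖ ^ 2 := by
  have h1 := norm_sq_sum_starProjection hT (fun _ => 1) v F
  simp only [one_smul, one_pow, one_mul] at h1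
  have h2 : ⟪∑ t ∈ F, (eigSpace T t).starProjection v, v⟫_ℝ
      = ∑ t ∈ F, ‖(eigSpace T t).starProjection v‖ ^ 2 := by
    rw [sum_inner]
    refine Finset.sum_congr rfl fun t _ => ?_
    rw [← real_inner_self_eq_norm_sq]
    have := Submodule.starProjection_inner_eq_zero (K := eigSpace T t) v
      ((eigSpace T t).starProjection v) (Submodule.starProjection_apply_mem _ v)
    rw [inner_sub_left, sub_eq_zero] at this
    rw [real_inner_comm, this]
  have h3 := real_inner_le_norm (∑ t ∈ F, (eigSpace T t).starProjection v) v
  rw [← h1] at h2 ⊢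
  rw [h2] at h3
  gcongr
  nlinarith [norm_nonneg (∑ t ∈ F, (eigSpace T t).starProjection v), norm_nonneg v]

theorem summable_spectralFun
    (hT : (T : H →ₗ[ℝ] H).IsSymmetric) {h : ℝ → ℝ} {M : ℝ} (hM : ∀ t, eigSpace T t ≠ ⊥ → |h t| ≤ M)
    (v : H) : Summable fun t => h t • (eigSpace T t).starProjection v := by
  have h1 : Summable fun t => ‖(eigSpace T t).starProjection v‖ ^ 2 :=
    summable_of_sum_le (fun _ => sq_nonneg _) (sum_norm_sq_starProjection_le hT v)
  have h2 : Summable fun t => h t ^ 2 * ‖(eigSpace T t).starProjection v‖ ^ 2 :=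
    Summable.of_nonneg_of_le (fun _ => by positivity) (sq_mul_norm_sq_le hM v)
      (h1.mul_left (M ^ 2))
  have h3 := (hT.orthogonalFamily_eigenspaces.summable_iff_norm_sq_summable
    (fun t => h t • ⟨(eigSpace T t).starProjection v,
      (eigSpace T t).starProjection_apply_mem v⟩)).2 (by simpa [norm_smul, mul_pow] using h2)
  simpa using h3

theorem norm_spectralFun_le
    (hT : (T : H →ₗ[ℝ] H).IsSymmetric) {h : ℝ → ℝ} {M : ℝ} (hM0 : 0 ≤ M)
    (hM : ∀ t, eigSpace T t ≠ ⊥ → |h t| ≤ M) (v : H) : ‖spectralFun h T v‖ ≤ M * ‖v‖ := by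
  refine le_of_tendsto (summable_spectralFun hT hM v).hasSum.norm (Eventually.of_forall fun F => ?_)
  refine (sq_le_sq₀ (norm_nonneg _) (by positivity)).1 ?_
  rw [norm_sq_sum_starProjection hT]
  calc _ ≤ ∑ t ∈ F, M ^ 2 * ‖(eigSpace T t).starProjection v‖ ^ 2 :=
        Finset.sum_le_sum fun t _ => sq_mul_norm_sq_le hM v t
    _ ≤ (M * ‖v‖) ^ 2 := by
        rw [← Finset.mul_sum, mul_pow]
        gcongr
        exact sum_norm_sq_starProjection_le hT v F

/-- Pythagoras on finite partial sums, then a limit. Values in `ℝ≥0∞` allow integration term by term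
later. -/
theorem enorm_sq_spectralFun_le
    (hT : (T : H →ₗ[ℝ] H).IsSymmetric) {h : ℝ → ℝ} {M : ℝ} (hM : ∀ t, eigSpace T t ≠ ⊥ → |h t| ≤ M)
    (v : H) : ‖spectralFun h T v‖ₑ ^ 2
      ≤ ∑' t, ENNReal.ofReal (h t ^ 2) * ‖(eigSpace T t).starProjection v‖ₑ ^ 2 := by
  refine le_of_tendsto (((ENNReal.continuous_pow 2).tendsto _).comp
    (summable_spectralFun hT hM v).hasSum.enorm) (Eventually.of_forall fun F => ?_)
  simp only [Function.comp_apply]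
  rw [enorm_sq_eq_ofReal, norm_sq_sum_starProjection hT,
    ENNReal.ofReal_sum_of_nonneg fun _ _ => by positivity]
  refine le_trans (Finset.sum_le_sum fun t _ => ?_) (ENNReal.sum_le_tsum F)
  rw [ENNReal.ofReal_mul (sq_nonneg _), enorm_sq_eq_ofReal]

/-- For `h` bounded on the eigenvalues, `h(T)` is a bounded operator. -/
theorem exists_clm_spectralFun
    (hT : (T : H →ₗ[ℝ] H).IsSymmetric) {h : ℝ → ℝ} {M : ℝ} (hM : ∀ t, eigSpace T t ≠ ⊥ → |h t| ≤ M) :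
    ∃ S : H →L[ℝ] H, ∀ v, S v = spectralFun h T v := by
  -- The sign of `M` is unknown when no eigenspace is nontrivial, hence `|M|`.
  have hM' : ∀ t, eigSpace T t ≠ ⊥ → |h t| ≤ |M| := fun t ht => (hM t ht).trans (le_abs_self M)
  refine ⟨LinearMap.mkContinuous
    { toFun := spectralFun h T
      map_add' := fun v w => ?_
      map_smul' := fun a v => ?_ } |M| fun v => norm_spectralFun_le hT (abs_nonneg M) hM' v,
    fun v => rfl⟩
  · simp only [spectralFun]
    rw [← (summable_spectralFun hT hM v).tsum_add (summable_spectralFun hT hM w)]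
    simp
  · simp only [spectralFun, RingHom.id_apply]
    rw [← (summable_spectralFun hT hM v).tsum_const_smul a]
    simp [smul_comm a]

theorem starProjection_spectralFun
    (hT : (T : H →ₗ[ℝ] H).IsSymmetric) {h : ℝ → ℝ} {M : ℝ}
    (hM : ∀ t, eigSpace T t ≠ ⊥ → |h t| ≤ M) (v : H) (t : ℝ) :
    (eigSpace T t).starProjection (spectralFun h T v) = h t • (eigSpace T t).starProjection v := by
  rw [spectralFun, ContinuousLinearMap.map_tsum _ (summable_spectralFun hT hM v),
    tsum_eq_single t]
  · rw [map_smul]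
    congr 1
    exact Submodule.starProjection_eq_self_iff.2 (Submodule.starProjection_apply_mem _ v)
  · intro t' ht'
    rw [map_smul, (Submodule.starProjection_apply_eq_zero_iff _).2, smul_zero]
    rw [Submodule.mem_orthogonal]
    intro u hu
    have := hT.orthogonalFamily_eigenspaces ht'.symm ⟨u, hu⟩
      ⟨_, (eigSpace T t').starProjection_apply_mem v⟩
    simpa using this

theorem starProjection_apply_eq_smul
    (hT : (T : H →ₗ[ℝ] H).IsSymmetric) (v : H) (t : ℝ) :
    (eigSpace T t).starProjection (T v) = t • (eigSpace T t).starProjection v := by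
  refine Submodule.eq_starProjection_of_mem_of_inner_eq_zero
    (Submodule.smul_mem _ _ (Submodule.starProjection_apply_mem _ v)) (fun w hw => ?_)
  have h1 := Submodule.starProjection_inner_eq_zero (K := eigSpace T t) v w hw
  have h2 : ⟪T v, w⟫_ℝ = ⟪v, T w⟫_ℝ := hT v w
  rw [inner_sub_left, sub_eq_zero] at h1
  rw [inner_sub_left, h2, mem_eigSpace_iff.1 hw, inner_smul_left, inner_smul_right, h1]
  simp

/-- The residual `h(T) T f - f` at `f = k(T) w`. -/
theorem norm_spectralFun_residual_le
    (hT : (T : H →ₗ[ℝ] H).IsSymmetric) {h k : ℝ → ℝ} {M N C : ℝ}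
    (hM : ∀ t, eigSpace T t ≠ ⊥ → |h t| ≤ M) (hN : ∀ t, eigSpace T t ≠ ⊥ → |k t| ≤ N)
    (hC0 : 0 ≤ C) (hC : ∀ t, eigSpace T t ≠ ⊥ → |k t * (1 - t * h t)| ≤ C) (w : H) :
    ‖spectralFun h T (T (spectralFun k T w)) - spectralFun k T w‖ ≤ C * ‖w‖ := by
  have h1 : spectralFun h T (T (spectralFun k T w)) - spectralFun k T w
      = spectralFun (fun t => -(k t * (1 - t * h t))) T w := by
    have ha := summable_spectralFun hT hM (T (spectralFun k T w))
    have hb := summable_spectralFun hT hN w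
    change (∑' t, h t • (eigSpace T t).starProjection (T (spectralFun k T w)))
      - (∑' t, k t • (eigSpace T t).starProjection w) = ∑' t, _
    rw [← ha.tsum_sub hb]
    refine tsum_congr fun t => ?_
    rw [starProjection_apply_eq_smul hT, starProjection_spectralFun hT hN]
    module
  rw [h1]
  exact norm_spectralFun_le hT hC0 (fun t ht => by rw [abs_neg]; exact hC t ht) w

end Spectral

/-! ### Means of independent Hilbert-space variables -/

section Probability

/-- A weakly measurable map into a separable Hilbert space is strongly measurable. -/
theorem aestronglyMeasurable_of_inner {Ω H : Type*} [MeasurableSpace Ω] {μ : Measure Ω}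
    [NormedAddCommGroup H] [InnerProductSpace ℝ H] [CompleteSpace H]
    [TopologicalSpace.SeparableSpace H] {ψ : Ω → H}
    (h : ∀ f : H, AEStronglyMeasurable (fun x => ⟪f, ψ x⟫_ℝ) μ) : AEStronglyMeasurable ψ μ := by
  obtain ⟨w, b, -⟩ := exists_hilbertBasis ℝ H
  have : Countable w := countable_of_orthonormal b.orthonormal
  refine aestronglyMeasurable_of_tendsto_ae (atTop : Filter (Finset w))
    (f := fun F x => ∑ i ∈ F, ⟪b i, ψ x⟫_ℝ • b i) (fun F => ?_) (ae_of_all _ fun x => ?_)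
  · exact Finset.aestronglyMeasurable_fun_sum F fun i _ => (h (b i)).smul_const (b i)
  · have := b.hasSum_repr (ψ x)
    simp only [b.repr_apply_apply] at this
    simpa [HasSum] using this

theorem lintegral_enorm_sq_eq_ofReal_integral {Ω E : Type*} [MeasurableSpace Ω] {μ : Measure Ω}
    [NormedAddCommGroup E] {f : Ω → E} (hf : MemLp f 2 μ) :
    ∫⁻ x, ‖f x‖ₑ ^ 2 ∂μ = ENNReal.ofReal (∫ x, ‖f x‖ ^ 2 ∂μ) := by
  rw [ofReal_integral_eq_lintegral_ofReal ((memLp_two_iff_integrable_sq_norm hf.1).1 hf)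
    (ae_of_all _ fun _ => sq_nonneg _)]
  simp_rw [enorm_sq_eq_ofReal]

theorem memLp_two_of_lintegral_lt_top {Ω E : Type*} [MeasurableSpace Ω] {μ : Measure Ω}
    [NormedAddCommGroup E] {f : Ω → E} (hf : AEStronglyMeasurable f μ)
    (h : ∫⁻ x, ‖f x‖ₑ ^ 2 ∂μ < ∞) : MemLp f 2 μ := by
  refine ⟨hf, ?_⟩
  rw [eLpNorm_lt_top_iff_lintegral_rpow_enorm_lt_top two_ne_zero ENNReal.ofNat_ne_top]
  simpa using h

/-- The mean of `n` independent copies of `Z` has variance at most `E‖Z‖² / n`. -/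
theorem lintegral_enorm_sq_mean_sub_le {Ω H : Type*} [MeasurableSpace Ω] {μ : Measure Ω}
    [IsProbabilityMeasure μ] [NormedAddCommGroup H] [InnerProductSpace ℝ H] [CompleteSpace H]
    [TopologicalSpace.SeparableSpace H] {Z : Ω → H} (hZ : MemLp Z 2 μ) {n : ℕ} (hn : n ≠ 0) :
    ∫⁻ ω : Fin n → Ω, ‖(1 / (n : ℝ)) • ∑ j, Z (ω j) - ∫ x, Z x ∂μ‖ₑ ^ 2
        ∂(Measure.pi fun _ : Fin n => μ)
      ≤ ENNReal.ofReal (1 / n) * ∫⁻ x, ‖Z x‖ₑ ^ 2 ∂μ := by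
  obtain ⟨w, b, -⟩ := exists_hilbertBasis ℝ H
  have : Countable w := countable_of_orthonormal b.orthonormal
  have hn' : (n : ℝ) ≠ 0 := by exact_mod_cast hn
  have hZj : ∀ j : Fin n, MemLp (fun ω : Fin n → Ω => Z (ω j)) 2 (Measure.pi fun _ : Fin n => μ) :=
    fun j => hZ.comp_measurePreserving (measurePreserving_eval (fun _ : Fin n => μ) j)
  have hmeas : AEStronglyMeasurable
      (fun ω : Fin n → Ω => (1 / (n : ℝ)) • ∑ j, Z (ω j) - ∫ x, Z x ∂μ)
      (Measure.pi fun _ : Fin n => μ) :=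
    ((Finset.aestronglyMeasurable_fun_sum _ fun j _ => (hZj j).1).const_smul _).sub
      aestronglyMeasurable_const
  -- In an orthonormal basis the claim splits into scalar variance bounds, one per coordinate.
  simp_rw [enorm_sq_eq_tsum b]
  rw [lintegral_tsum fun i => ((aestronglyMeasurable_const.inner hmeas).enorm.pow_const 2),
    lintegral_tsum fun i => ((aestronglyMeasurable_const.inner hZ.1).enorm.pow_const 2),
    ← ENNReal.tsum_mul_left]
  refine ENNReal.tsum_le_tsum fun i => ?_
  have hf : MemLp (fun x => ⟪b i, Z x⟫_ℝ) 2 μ := hZ.const_inner (b i)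
  set f : Ω → ℝ := fun x => ⟪b i, Z x⟫_ℝ with hfdef
  have hfj : ∀ j : Fin n, MemLp (fun ω : Fin n → Ω => f (ω j)) 2 (Measure.pi fun _ : Fin n => μ) :=
    fun j => hf.comp_measurePreserving (measurePreserving_eval (fun _ : Fin n => μ) j)
  have hmean : ∫ ω : Fin n → Ω, (1 / (n : ℝ)) * ∑ j, f (ω j) ∂(Measure.pi fun _ : Fin n => μ)
      = ∫ x, f x ∂μ := by
    rw [integral_const_mul, integral_finsetSum _ fun j _ => (hfj j).integrable one_le_two]
    simp_rw [integral_comp_eval (μ := fun _ : Fin n => μ) hf.1]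
    simp [hn']
  have hinner : ∀ ω : Fin n → Ω, ⟪b i, (1 / (n : ℝ)) • ∑ j, Z (ω j) - ∫ x, Z x ∂μ⟫_ℝ
      = (1 / (n : ℝ)) * ∑ j, f (ω j)
        - ∫ ω : Fin n → Ω, (1 / (n : ℝ)) * ∑ j, f (ω j) ∂(Measure.pi fun _ : Fin n => μ) := by
    intro ω
    rw [hmean, inner_sub_right, inner_smul_right, inner_sum,
      ← integral_inner (hZ.integrable one_le_two)]
  simp_rw [hinner]
  change evariance (fun ω : Fin n → Ω => (1 / (n : ℝ)) * ∑ j, f (ω j)) _ ≤ _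
  have hsum : MemLp (fun ω : Fin n → Ω => ∑ j, f (ω j)) 2 (Measure.pi fun _ : Fin n => μ) :=
    memLp_finsetSum _ fun j _ => hfj j
  have hvar := variance_sum_pi (μ := fun _ : Fin n => μ) (X := fun _ => f) fun _ => hf
  have hfun : (∑ j : Fin n, fun ω : Fin n → Ω => f (ω j)) = fun ω => ∑ j, f (ω j) := by
    ext ω
    simp
  rw [hfun] at hvar
  rw [← ofReal_variance (hsum.const_mul _), variance_const_mul, hvar,
    lintegral_enorm_sq_eq_ofReal_integral hf, ← ENNReal.ofReal_mul (by positivity)]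
  refine ENNReal.ofReal_le_ofReal ?_
  have h1 : Var[f; μ] ≤ ∫ x, ‖f x‖ ^ 2 ∂μ := by
    have := variance_le_expectation_sq hf.1
    simpa using this
  have h2 : (1 / (n : ℝ)) ^ 2 * ∑ _j : Fin n, Var[f; μ] = 1 / n * Var[f; μ] := by
    simp
    field_simp
  rw [h2]
  gcongr

theorem memLp_mean_sub {Ω H : Type*} [MeasurableSpace Ω] {μ : Measure Ω}
    [IsProbabilityMeasure μ] [NormedAddCommGroup H] [InnerProductSpace ℝ H] {Z : Ω → H}
    (hZ : MemLp Z 2 μ) (n : ℕ) (a : H) :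
    MemLp (fun ω : Fin n → Ω => (1 / (n : ℝ)) • ∑ j, Z (ω j) - a) 2
      (Measure.pi fun _ : Fin n => μ) :=
  ((memLp_finsetSum _ fun j _ => hZ.comp_measurePreserving
    (measurePreserving_eval (fun _ : Fin n => μ) j)).const_smul _).sub (memLp_const a)

/-- Bias-variance bound for the mean of `n` independent copies of `Z`. -/
theorem integral_norm_sq_mean_sub_le {Ω H : Type*} [MeasurableSpace Ω] {μ : Measure Ω}
    [IsProbabilityMeasure μ] [NormedAddCommGroup H] [InnerProductSpace ℝ H] [CompleteSpace H]
    [TopologicalSpace.SeparableSpace H] {Z : Ω → H} (hZ : MemLp Z 2 μ) {n : ℕ} (hn : n ≠ 0)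
    {V : ℝ} (hV0 : 0 ≤ V) (hV : ∫⁻ x, ‖Z x‖ₑ ^ 2 ∂μ ≤ ENNReal.ofReal V) (a : H) :
    ∫ ω : Fin n → Ω, ‖(1 / (n : ℝ)) • ∑ j, Z (ω j) - a‖ ^ 2 ∂(Measure.pi fun _ : Fin n => μ)
      ≤ 2 * (1 / n * V) + 2 * ‖∫ x, Z x ∂μ - a‖ ^ 2 := by
  have hm := memLp_mean_sub hZ n (∫ x, Z x ∂μ)
  have hvar : ∫ ω : Fin n → Ω, ‖(1 / (n : ℝ)) • ∑ j, Z (ω j) - ∫ x, Z x ∂μ‖ ^ 2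
      ∂(Measure.pi fun _ : Fin n => μ) ≤ 1 / n * V := by
    rw [← ENNReal.ofReal_le_ofReal_iff (by positivity), ← lintegral_enorm_sq_eq_ofReal_integral hm,
      ENNReal.ofReal_mul (by positivity)]
    exact (lintegral_enorm_sq_mean_sub_le hZ hn).trans (by gcongr)
  have hmi := (memLp_two_iff_integrable_sq_norm hm.1).1 hm
  have ha := memLp_mean_sub hZ n a
  calc _ ≤ ∫ ω : Fin n → Ω, (2 * ‖(1 / (n : ℝ)) • ∑ j, Z (ω j) - ∫ x, Z x ∂μ‖ ^ 2
          + 2 * ‖∫ x, Z x ∂μ - a‖ ^ 2) ∂(Measure.pi fun _ : Fin n => μ) := by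
        refine integral_mono ((memLp_two_iff_integrable_sq_norm ha.1).1 ha)
          ((hmi.const_mul 2).add (integrable_const _)) fun ω => ?_
        have h1 := norm_sub_le_norm_sub_add_norm_sub ((1 / (n : ℝ)) • ∑ j, Z (ω j))
          (∫ x, Z x ∂μ) a
        have h2 := pow_le_pow_left₀ (norm_nonneg _) h1 2
        have h3 := add_sq_le (a := ‖(1 / (n : ℝ)) • ∑ j, Z (ω j) - ∫ x, Z x ∂μ‖)
          (b := ‖∫ x, Z x ∂μ - a‖)
        simp only
        linarith
    _ = 2 * (∫ ω : Fin n → Ω, ‖(1 / (n : ℝ)) • ∑ j, Z (ω j) - ∫ x, Z x ∂μ‖ ^ 2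
          ∂(Measure.pi fun _ : Fin n => μ)) + 2 * ‖∫ x, Z x ∂μ - a‖ ^ 2 := by
        rw [integral_add (hmi.const_mul 2) (integrable_const _), integral_const_mul]
        simp
    _ ≤ _ := by gcongr

end Probability

/-! ### Second moments under the sampling model -/

section Model

variable {X : Type*} [MeasurableSpace X] {ρ : Measure (X × ℝ)} {H : Type*} [NormedAddCommGroup H]

theorem measurePreserving_fst_marginal : MeasurePreserving Prod.fst ρ ρ.fst :=
  ⟨measurable_fst, rfl⟩

theorem IsSamplingModel.lintegral_sq [IsProbabilityMeasure ρ] {y : X → ℝ} {σ : ℝ}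
    (h : IsSamplingModel ρ y σ) :
    ∀ᵐ x ∂ρ.fst, ∫⁻ u, ‖u‖ₑ ^ 2 ∂(ρ.condKernel x) = ENNReal.ofReal (σ ^ 2 + y x ^ 2) := by
  filter_upwards [h.memLp_two, h.cond_mean, h.cond_variance] with x h1 h2 h3
  rw [lintegral_enorm_sq_eq_ofReal_integral h1]
  rw [variance_eq_sub h1, h2] at h3
  congr 1
  simp only [Real.norm_eq_abs, sq_abs]
  simp only [Pi.pow_apply] at h3
  linarith

/-- Disintegrate `ρ` along `X`: the inner integral of `Y²` is `σ² + y(x)²`. -/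
theorem IsSamplingModel.lintegral_enorm_sq_smul_le [IsProbabilityMeasure ρ] [NormedSpace ℝ H]
    {y : X → ℝ} {σ K : ℝ}
    (h : IsSamplingModel ρ y σ)
    (hK : ∀ᵐ x ∂ρ.fst, σ ^ 2 + y x ^ 2 ≤ K) {ψ : X → H} (hψ : AEStronglyMeasurable ψ ρ.fst) :
    ∫⁻ z, ‖z.2 • ψ z.1‖ₑ ^ 2 ∂ρ ≤ ENNReal.ofReal K * ∫⁻ x, ‖ψ x‖ₑ ^ 2 ∂ρ.fst := by
  -- Disintegration is applied to a measurable integrand, so `‖ψ‖²` is replaced by a measurable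
  -- version.
  have hg : AEMeasurable (fun x => ‖ψ x‖ₑ ^ 2) ρ.fst := hψ.enorm.pow_const 2
  set g := hg.mk with hgdef
  have hgm : Measurable g := hg.measurable_mk
  have hge := hg.ae_eq_mk
  have h1 : ∫⁻ z, ‖z.2 • ψ z.1‖ₑ ^ 2 ∂ρ = ∫⁻ z, ‖z.2‖ₑ ^ 2 * g z.1 ∂ρ := by
    refine lintegral_congr_ae ?_
    filter_upwards [measurePreserving_fst_marginal.quasiMeasurePreserving.ae hge] with z hz
    rw [enorm_smul, mul_pow, hz]
  rw [h1, lintegral_congr_ae hge, ← Measure.lintegral_condKernel (by fun_prop),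
    ← lintegral_const_mul _ hgm]
  refine lintegral_mono_ae ?_
  filter_upwards [h.lintegral_sq, hK] with x hx hKx
  rw [lintegral_mul_const _ (by fun_prop), hx]
  gcongr

theorem aestronglyMeasurable_smul_fst [NormedSpace ℝ H] {ψ : X → H}
    (hψ : AEStronglyMeasurable ψ ρ.fst) :
    AEStronglyMeasurable (fun z : X × ℝ => z.2 • ψ z.1) ρ :=
  (measurable_snd.aestronglyMeasurable).smul
    (hψ.comp_measurePreserving measurePreserving_fst_marginal)

variable [InnerProductSpace ℝ H] {A : H →L[ℝ] Lp ℝ 2 ρ.fst}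

section NormalOp

variable [CompleteSpace H]

theorem inner_normalOp (f g : H) : ⟪f, normalOp A g⟫_ℝ = ⟪A f, A g⟫_ℝ := by
  simp [normalOp, ContinuousLinearMap.adjoint_inner_right]

theorem isSymmetric_normalOp : (normalOp A : H →ₗ[ℝ] H).IsSymmetric := by
  intro f g
  change ⟪normalOp A f, g⟫_ℝ = ⟪f, normalOp A g⟫_ℝ
  rw [real_inner_comm, inner_normalOp, inner_normalOp, real_inner_comm]

theorem norm_sq_apply_of_mem_eigSpace {t : ℝ} {v : H} (hv : v ∈ eigSpace (normalOp A) t) :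
    ‖A v‖ ^ 2 = t * ‖v‖ ^ 2 := by
  rw [← real_inner_self_eq_norm_sq, ← inner_normalOp, mem_eigSpace_iff.1 hv, inner_smul_right,
    real_inner_self_eq_norm_sq]

theorem eigenvalue_nonneg {t : ℝ} (h : eigSpace (normalOp A) t ≠ ⊥) : 0 ≤ t := by
  obtain ⟨v, hv, hv0⟩ := (Submodule.ne_bot_iff _).1 h
  have h1 := norm_sq_apply_of_mem_eigSpace hv
  have h2 : 0 < ‖v‖ ^ 2 := by positivity
  by_contra! h3
  nlinarith [sq_nonneg ‖A v‖]

end NormalOp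

variable {φ : X → H}

theorem aestronglyMeasurable_inner_feature
    (hA : ∀ f : H, (A f : X → ℝ) =ᵐ[ρ.fst] fun x => inner ℝ f (φ x))
    (f : H) :
    AEStronglyMeasurable (fun x => ⟪f, φ x⟫_ℝ) ρ.fst :=
  (Lp.aestronglyMeasurable (A f)).congr (hA f)

theorem lintegral_enorm_sq_inner_feature
    (hA : ∀ f : H, (A f : X → ℝ) =ᵐ[ρ.fst] fun x => inner ℝ f (φ x))
    (f : H) :
    ∫⁻ x, ‖⟪f, φ x⟫_ℝ‖ₑ ^ 2 ∂ρ.fst = ENNReal.ofReal (‖A f‖ ^ 2) := by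
  have h1 : ∫⁻ x, ‖⟪f, φ x⟫_ℝ‖ₑ ^ 2 ∂ρ.fst = ∫⁻ x, ‖A f x‖ₑ ^ 2 ∂ρ.fst :=
    lintegral_congr_ae ((hA f).mono fun x hx => by simp only [hx])
  rw [h1, lintegral_enorm_sq_eq_ofReal_integral (Lp.memLp (A f)), ← real_inner_self_eq_norm_sq,
    L2.inner_def]
  simp only [real_inner_self_eq_norm_sq]

variable [CompleteSpace H]

/-- `E(Y φ_X) = A^* A f` when `E(Y | X) = A f`. -/
theorem integral_smul_feature
    (hA : ∀ f : H, (A f : X → ℝ) =ᵐ[ρ.fst] fun x => inner ℝ f (φ x))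
    [IsProbabilityMeasure ρ] {f : H} {σ : ℝ} (hmodel : IsSamplingModel ρ (A f) σ)
    (hint : Integrable (fun z : X × ℝ => z.2 • φ z.1) ρ) :
    ∫ z, z.2 • φ z.1 ∂ρ = normalOp A f := by
  -- Weakly against `g`, both sides are `∫ (A g)(A f)`.
  refine ext_inner_left ℝ fun g => ?_
  rw [← integral_inner hint, ← Measure.integral_condKernel (hint.const_inner g), inner_normalOp,
    L2.inner_def]
  refine integral_congr_ae ?_
  filter_upwards [hmodel.cond_mean, hA g] with x h1 h2
  simp only [inner_smul_right]
  rw [integral_mul_const, h1, h2]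
  rfl

variable [TopologicalSpace.SeparableSpace H]

theorem aestronglyMeasurable_feature
    (hA : ∀ f : H, (A f : X → ℝ) =ᵐ[ρ.fst] fun x => inner ℝ f (φ x)) :
    AEStronglyMeasurable φ ρ.fst :=
  aestronglyMeasurable_of_inner (aestronglyMeasurable_inner_feature hA)

/-- `E‖P_t φ_X‖²` is at most `t` times the multiplicity of `t`. -/
theorem lintegral_enorm_sq_starProjection_le
    (hA : ∀ f : H, (A f : X → ℝ) =ᵐ[ρ.fst] fun x => inner ℝ f (φ x))
    (t : ℝ) :
    ∫⁻ x, ‖(eigSpace (normalOp A) t).starProjection (φ x)‖ₑ ^ 2 ∂ρ.fst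
      ≤ (Cardinal.toENat (Module.rank ℝ (eigSpace (normalOp A) t)) : ℝ≥0∞)
        * ENNReal.ofReal t := by
  obtain ⟨w, b, -⟩ := exists_hilbertBasis ℝ (eigSpace (normalOp A) t)
  have : Countable w := countable_of_orthonormal b.orthonormal
  have h1 : ∀ x, ‖(eigSpace (normalOp A) t).starProjection (φ x)‖ₑ ^ 2
      = ∑' i, ‖⟪(b i : H), φ x⟫_ℝ‖ₑ ^ 2 := by
    intro x
    have h2 := enorm_sq_eq_tsum b ((eigSpace (normalOp A) t).orthogonalProjectionOnto (φ x))
    simp only [Submodule.inner_orthogonalProjectionOnto_eq_of_mem_left] at h2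
    rw [← h2]
    rfl
  simp_rw [h1]
  rw [lintegral_tsum fun i =>
    (aestronglyMeasurable_inner_feature hA (b i)).enorm.pow_const 2]
  -- For a unit eigenvector `e`, `E⟨e, φ_X⟩² = ‖A e‖² = t`; each basis vector of the eigenspace
  -- contributes this once.
  have h3 : ∀ i, ∫⁻ x, ‖⟪(b i : H), φ x⟫_ℝ‖ₑ ^ 2 ∂ρ.fst = ENNReal.ofReal t := by
    intro i
    rw [lintegral_enorm_sq_inner_feature hA, norm_sq_apply_of_mem_eigSpace (b i).2]
    have := b.orthonormal.1 i
    rw [Submodule.coe_norm] at this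
    rw [this]
    simp
  simp_rw [h3]
  rw [ENNReal.tsum_const]
  gcongr
  have := OrderHom.mono (β := ℕ∞) Cardinal.toENat b.orthonormal.linearIndependent.cardinal_le_rank
  simpa [ENat.card] using this

/-- `E‖h(B) φ_X‖²` is at most `∑ h(μ_j)² μ_j`. -/
theorem lintegral_enorm_sq_spectralFun_le
    (hA : ∀ f : H, (A f : X → ℝ) =ᵐ[ρ.fst] fun x => inner ℝ f (φ x))
    {ev : ℕ → ℝ} (hev : IsEigenvalueList (normalOp A) ev)
    {h : ℝ → ℝ} {M : ℝ} (hM : ∀ t, eigSpace (normalOp A) t ≠ ⊥ → |h t| ≤ M) :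
    ∫⁻ x, ‖spectralFun h (normalOp A) (φ x)‖ₑ ^ 2 ∂ρ.fst
      ≤ ∑' j, ENNReal.ofReal (h (ev j) ^ 2 * ev j) := by
  -- A countable set carrying all eigenvalues, so that sum and integral may be exchanged.
  set Z : Set ℝ := insert 0 (Set.range ev) with hZ
  have hZc : Countable Z := ((Set.countable_range ev).insert 0).to_subtype
  have hbot : ∀ t ∉ Z, eigSpace (normalOp A) t = ⊥ := by
    intro t ht
    rw [hZ, Set.mem_insert_iff, not_or] at ht
    have h1 := hev t ht.1
    have h2 : {j | ev j = t} = ∅ := by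
      ext j
      exact ⟨fun hj => ht.2 ⟨j, hj⟩, fun hj => hj.elim⟩
    rw [h2, Set.encard_empty, eq_comm, Cardinal.toENat_eq_zero] at h1
    exact Submodule.rank_eq_zero.1 h1
  have hterm : ∀ t, ENNReal.ofReal (h t ^ 2)
      * ∫⁻ x, ‖(eigSpace (normalOp A) t).starProjection (φ x)‖ₑ ^ 2 ∂ρ.fst
      ≤ ∑' j : {j // ev j = t}, ENNReal.ofReal (h (ev j) ^ 2 * ev j) := by
    intro t
    have h1 : ∑' j : {j // ev j = t}, ENNReal.ofReal (h (ev j) ^ 2 * ev j)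
        = ({j | ev j = t}.encard : ℝ≥0∞) * ENNReal.ofReal (h t ^ 2 * t) := by
      rw [← ENNReal.tsum_set_const]
      exact tsum_congr fun j => by rw [j.2]
    refine (mul_le_mul_right (lintegral_enorm_sq_starProjection_le hA t) _).trans ?_
    -- The list does not record the multiplicity of `0`, but the factor `t` kills the kernel even
    -- when it is infinite-dimensional.
    by_cases ht : t = 0
    · simp [ht]
    · rw [h1, hev t ht, ENNReal.ofReal_mul (sq_nonneg _)]
      exact le_of_eq (by ring)
  have hpm : ∀ t : ℝ, AEMeasurable
      (fun x => ‖(eigSpace (normalOp A) t).starProjection (φ x)‖ₑ ^ 2) ρ.fst := fun t =>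
    ((ContinuousLinearMap.continuous _).comp_aestronglyMeasurable
      (aestronglyMeasurable_feature hA)).enorm.pow_const 2
  calc ∫⁻ x, ‖spectralFun h (normalOp A) (φ x)‖ₑ ^ 2 ∂ρ.fst
      ≤ ∫⁻ x, ∑' t : Z, ENNReal.ofReal (h t ^ 2)
          * ‖(eigSpace (normalOp A) t).starProjection (φ x)‖ₑ ^ 2 ∂ρ.fst := by
        refine lintegral_mono fun x => (enorm_sq_spectralFun_le isSymmetric_normalOp hM _).trans ?_
        rw [tsum_subtype_eq_of_support_subset (f := fun t : ℝ => ENNReal.ofReal (h t ^ 2)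
          * ‖(eigSpace (normalOp A) t).starProjection (φ x)‖ₑ ^ 2)]
        intro t ht
        by_contra htZ
        exact ht (by simp [starProjection_eq_zero_of_eq_bot (hbot t htZ)])
    _ = ∑' t : Z, ENNReal.ofReal (h t ^ 2)
          * ∫⁻ x, ‖(eigSpace (normalOp A) t).starProjection (φ x)‖ₑ ^ 2 ∂ρ.fst := by
        rw [lintegral_tsum fun t : Z => (hpm t).const_mul _]
        exact tsum_congr fun t => lintegral_const_mul'' _ (hpm t)
    _ ≤ ∑' t : Z, ∑' j : {j // ev j = t}, ENNReal.ofReal (h (ev j) ^ 2 * ev j) :=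
        ENNReal.tsum_le_tsum fun t => hterm t
    _ ≤ ∑' t : ℝ, ∑' j : {j // ev j = t}, ENNReal.ofReal (h (ev j) ^ 2 * ev j) :=
        ENNReal.tsum_comp_le_tsum_of_injective Subtype.coe_injective _
    _ = ∑' j, ENNReal.ofReal (h (ev j) ^ 2 * ev j) := by
        rw [← ENNReal.tsum_sigma, ← (Equiv.sigmaFiberEquiv ev).tsum_eq]
        rfl

end Model

/-! ### Summation under polynomial eigenvalue decay -/

section Decay

/-- The plateau on `(0, M]` contributes `M^(1-b)`, the tail `M^(1-b) / (b-1)`. -/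
theorem integrableOn_and_integral_max_rpow {b M : ℝ} (hb : 1 < b) (hM : 0 < M) :
    IntegrableOn (fun x : ℝ => max x M ^ (-b)) (Set.Ioi 0) ∧
      ∫ x in Set.Ioi 0, max x M ^ (-b) = b / (b - 1) * M ^ (1 - b) := by
  have h1 : Set.EqOn (fun x : ℝ => max x M ^ (-b)) (fun _ => M ^ (-b)) (Set.Ioc 0 M) :=
    fun x hx => by simp only [max_eq_right hx.2]
  have h2 : Set.EqOn (fun x : ℝ => max x M ^ (-b)) (fun x => x ^ (-b)) (Set.Ioi M) :=
    fun x hx => by simp only [max_eq_left (Set.mem_Ioi.1 hx).le]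
  have i1 : IntegrableOn (fun x : ℝ => max x M ^ (-b)) (Set.Ioc 0 M) :=
    (integrableOn_congr_fun h1 measurableSet_Ioc).2 (integrableOn_const (by simp))
  have i2 : IntegrableOn (fun x : ℝ => max x M ^ (-b)) (Set.Ioi M) :=
    (integrableOn_congr_fun h2 measurableSet_Ioi).2
      (integrableOn_Ioi_rpow_of_lt (by linarith) hM)
  rw [← Set.Ioc_union_Ioi_eq_Ioi hM.le]
  refine ⟨i1.union i2, ?_⟩
  rw [setIntegral_union (Set.Ioc_disjoint_Ioi le_rfl) measurableSet_Ioi i1 i2,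
    setIntegral_congr_fun measurableSet_Ioc h1, setIntegral_congr_fun measurableSet_Ioi h2,
    integral_Ioi_rpow_of_lt (by linarith) hM]
  have h3 : M ^ (1 - b) = M * M ^ (-b) := by
    rw [sub_eq_add_neg, Real.rpow_add hM, Real.rpow_one]
  have h4 : -b + 1 = 1 - b := by ring
  have h5 : (b - 1) ≠ 0 := by linarith
  have h6 : (1 - b) ≠ 0 := by linarith
  simp only [setIntegral_const, measureReal_def, Real.volume_Ioc, sub_zero, smul_eq_mul,
    ENNReal.toReal_ofReal hM.le]
  rw [h4, ← h3]
  field_simp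
  ring

/-- `∑ min(1, u / (j+1)^b) = O(u^{1/b})`. -/
theorem tsum_le_of_le_one_of_le_div {b u : ℝ} (hb : 1 < b) (hu : 0 < u) {a : ℕ → ℝ}
    (h1 : ∀ j, a j ≤ 1) (hab : ∀ j : ℕ, a j ≤ u / ((j : ℝ) + 1) ^ b) :
    ∑' j, ENNReal.ofReal (a j) ≤ ENNReal.ofReal (b / (b - 1) * u ^ (1 / b)) := by
  have hb0 : 0 < b := by linarith
  -- The crossover point `u / M^b = 1`; below, `u * f x = min(1, u / x^b)` for `x > 0`.
  set M := u ^ (1 / b) with hMdef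
  have hM : 0 < M := Real.rpow_pos_of_pos hu _
  have hMb : M ^ b = u := by
    rw [hMdef, ← Real.rpow_mul hu.le, one_div, inv_mul_cancel₀ hb0.ne', Real.rpow_one]
  obtain ⟨hint, hval⟩ := integrableOn_and_integral_max_rpow hb hM
  set f : ℝ → ℝ := fun x => max x M ^ (-b) with hf
  have hpos : ∀ x, 0 < max x M := fun x => lt_of_lt_of_le hM (le_max_right _ _)
  have hanti : Antitone f := fun x y hxy =>
    Real.rpow_le_rpow_of_nonpos (hpos x) (max_le_max_right M hxy) (by linarith)
  have hf0 : ∀ x, 0 ≤ f x := fun x => (Real.rpow_pos_of_pos (hpos x) _).le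
  have haf : ∀ j : ℕ, a j ≤ u * f ((j + 1 : ℕ)) := by
    intro j
    simp only [hf]
    push_cast
    rcases le_total ((j : ℝ) + 1) M with h | h
    · rw [max_eq_right h, Real.rpow_neg hM.le, hMb, mul_inv_cancel₀ hu.ne']
      exact h1 j
    · rw [max_eq_left h, Real.rpow_neg (by positivity), ← div_eq_mul_inv]
      exact hab j
  have hfin : u * (b / (b - 1) * M ^ (1 - b)) = b / (b - 1) * M := by
    rw [Real.rpow_sub hM, Real.rpow_one, hMb]
    field_simp
  refine ENNReal.tsum_le_of_sum_range_le fun N => ?_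
  calc ∑ j ∈ Finset.range N, ENNReal.ofReal (a j)
      ≤ ∑ j ∈ Finset.range N, ENNReal.ofReal (u * f ((j + 1 : ℕ))) :=
        Finset.sum_le_sum fun j _ => ENNReal.ofReal_le_ofReal (haf j)
    _ = ENNReal.ofReal (u * ∑ j ∈ Finset.range N, f ((j + 1 : ℕ))) := by
        rw [Finset.mul_sum, ENNReal.ofReal_sum_of_nonneg fun j _ => mul_nonneg hu.le (hf0 _)]
    _ ≤ _ := by
        refine ENNReal.ofReal_le_ofReal ?_
        rw [← hfin, ← hval]
        gcongr
        exact AntitoneOn.sum_range_le_integral (hanti.antitoneOn _) hint fun t _ => hf0 t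

end Decay

/-! ### Variance, bias and finite-sample risk -/

section Rate

section

variable {H : Type*} [NormedAddCommGroup H] [InnerProductSpace ℝ H]

theorem IsEigenvalueList.eigSpace_ne_bot {T : H →L[ℝ] H} {ev : ℕ → ℝ}
    (hev : IsEigenvalueList T ev) {j : ℕ} (hj : ev j ≠ 0) : eigSpace T (ev j) ≠ ⊥ := by
  intro h
  have h1 := hev (ev j) hj
  rw [h, rank_bot, map_zero, Set.encard_eq_zero] at h1
  exact (h1 ▸ (rfl : ev j = ev j) : j ∈ (∅ : Set ℕ))

theorem IsFilterFamily.exists_abs_le {T : H →L[ℝ] H} {s : ℝ → ℝ → ℝ} {q : ℝ}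
    (hs : IsFilterFamily T s q) :
    ∃ E > 0, ∀ l > 0, ∀ t, eigSpace T t ≠ ⊥ → |s l t| ≤ E / l := by
  obtain ⟨E, hE, hEb⟩ := hs.bound_param
  refine ⟨E, hE, fun l hl t ht => ?_⟩
  have := hEb l hl t (eigSpace_ne_bot_mem_spectrum ht)
  rw [abs_mul, abs_of_pos hl] at this
  rw [le_div_iff₀ hl]
  linarith

end

variable {X : Type*} [MeasurableSpace X] {ρ : Measure (X × ℝ)}
  {H : Type*} [NormedAddCommGroup H] [InnerProductSpace ℝ H] [CompleteSpace H]

variable {A : H →L[ℝ] Lp ℝ 2 ρ.fst} {φ : X → H}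

/-- The variance factor: `E‖s_l(B) φ_X‖² = O(l^{-(1 + 1/b)})`, uniformly in `l > 0`. -/
theorem exists_lintegral_filter_le [TopologicalSpace.SeparableSpace H]
    (hA : ∀ f : H, (A f : X → ℝ) =ᵐ[ρ.fst] fun x => inner ℝ f (φ x))
    {s : ℝ → ℝ → ℝ} {q : ℝ} (hs : IsFilterFamily (normalOp A) s q)
    {ev : ℕ → ℝ} (hev : IsEigenvalueList (normalOp A) ev)
    {d b : ℝ} (hd : 0 < d) (hb : 1 < b) (hdecay : ∀ j : ℕ, ev j ≤ d / ((j : ℝ) + 1) ^ b) :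
    ∃ K : ℝ, 0 ≤ K ∧ ∀ l > 0, ∫⁻ x, ‖spectralFun (s l) (normalOp A) (φ x)‖ₑ ^ 2 ∂ρ.fst
      ≤ ENNReal.ofReal (K * l ^ (-(1 + 1 / b))) := by
  obtain ⟨D, hD, hDb⟩ := hs.bound_mul
  obtain ⟨E, hE, hEb⟩ := hs.exists_abs_le
  -- One constant dominating both bounds: `D * E` from `|s| |t s|`, and `E² d` from `s² t` with the
  -- decay.
  set k := D * E + E ^ 2 * d with hk
  have hk0 : 0 < k := by positivity
  refine ⟨k * (b / (b - 1)), mul_nonneg hk0.le (div_nonneg (by linarith) (by linarith)),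
    fun l hl => ?_⟩
  -- A padding entry `0` need not lie in the spectrum, where alone the filter is controlled; its
  -- term vanishes anyway.
  have hterm : ∀ j, ev j = 0 ∨ (s l (ev j) ^ 2 * ev j ≤ k / l ∧
      s l (ev j) ^ 2 * ev j ≤ k / l * ((1 / l) / ((j : ℝ) + 1) ^ b)) := by
    intro j
    refine or_iff_not_imp_left.2 fun hj => ?_
    have hne := hev.eigSpace_ne_bot hj
    have hspec := eigSpace_ne_bot_mem_spectrum hne
    have ht0 : 0 ≤ ev j := eigenvalue_nonneg hne
    have h1 := hEb l hl _ hne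
    have h2 := hDb l hl _ hspec
    have h3 : s l (ev j) ^ 2 * ev j = |s l (ev j)| * |ev j * s l (ev j)| := by
      rw [abs_mul, abs_of_nonneg ht0, ← sq_abs]
      ring
    constructor
    · calc s l (ev j) ^ 2 * ev j ≤ E / l * D := by rw [h3]; gcongr
        _ = D * E / l := by ring
        _ ≤ k / l := by
          gcongr
          rw [hk]
          linarith [show 0 < E ^ 2 * d by positivity]
    · calc s l (ev j) ^ 2 * ev j ≤ (E / l) ^ 2 * (d / ((j : ℝ) + 1) ^ b) := by
            rw [← sq_abs]
            gcongr
            exact hdecay j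
        _ = E ^ 2 * d / l * ((1 / l) / ((j : ℝ) + 1) ^ b) := by field_simp
        _ ≤ k / l * ((1 / l) / ((j : ℝ) + 1) ^ b) := by
          gcongr
          rw [hk]
          linarith [show 0 < D * E by positivity]
  have hkl : 0 < k / l := by positivity
  have hsum := tsum_le_of_le_one_of_le_div (u := 1 / l)
    (a := fun j => (k / l)⁻¹ * (s l (ev j) ^ 2 * ev j)) hb (by positivity)
    (fun j => by
      rcases hterm j with h | h
      · simp [h]
      · rw [inv_mul_le_iff₀ hkl, mul_one]
        exact h.1)
    (fun j => by
      rcases hterm j with h | h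
      · simp only [h, mul_zero]
        positivity
      · rw [inv_mul_le_iff₀ hkl]
        exact h.2)
  refine (lintegral_enorm_sq_spectralFun_le hA hev (hEb l hl)).trans ?_
  calc ∑' j, ENNReal.ofReal (s l (ev j) ^ 2 * ev j)
      = ENNReal.ofReal (k / l)
        * ∑' j, ENNReal.ofReal ((k / l)⁻¹ * (s l (ev j) ^ 2 * ev j)) := by
        rw [← ENNReal.tsum_mul_left]
        refine tsum_congr fun j => ?_
        rw [← ENNReal.ofReal_mul hkl.le, mul_inv_cancel_left₀ hkl.ne']
    _ ≤ ENNReal.ofReal (k / l) * ENNReal.ofReal (b / (b - 1) * (1 / l) ^ (1 / b)) := by gcongr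
    _ = ENNReal.ofReal (k * (b / (b - 1)) * l ^ (-(1 + 1 / b))) := by
        rw [← ENNReal.ofReal_mul hkl.le]
        congr 1
        rw [neg_add, Real.rpow_add hl, Real.rpow_neg_one, Real.rpow_neg hl.le, one_div l,
          Real.inv_rpow hl.le]
        ring

/-- The bias: `‖s_l(B) B f - f‖ = O(l^r)` on the source set of order `r`. -/
theorem exists_norm_residual_le {s : ℝ → ℝ → ℝ} {q : ℝ} (hs : IsFilterFamily (normalOp A) s q)
    {r R : ℝ} (hr : 0 < r) (hrq : r ≤ q) {f : H} (hf : f ∈ sourceSet (normalOp A) r R) :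
    ∃ C : ℝ, 0 ≤ C ∧ ∀ l > 0,
      ‖spectralFun (s l) (normalOp A) (normalOp A f) - f‖ ≤ C * l ^ r := by
  obtain ⟨w, -, rfl⟩ := hf
  obtain ⟨E, hE, hEb⟩ := hs.exists_abs_le
  obtain ⟨C, hC, hCb⟩ := hs.qualification r hr.le hrq
  refine ⟨C * ‖w‖, by positivity, fun l hl => ?_⟩
  have := norm_spectralFun_residual_le (T := normalOp A) isSymmetric_normalOp (h := s l)
    (k := fun t => t ^ r) (M := E / l) (N := ‖normalOp A‖ ^ r) (C := C * l ^ r)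
    (hEb l hl)
    (fun t ht => by
      have h0 := eigenvalue_nonneg ht
      have h1 := abs_le_opNorm_of_eigSpace_ne_bot ht
      rw [abs_of_nonneg h0] at h1
      rw [abs_of_nonneg (Real.rpow_nonneg h0 r)]
      exact Real.rpow_le_rpow h0 h1 hr.le)
    (by positivity) (fun t ht => hCb l hl t (eigSpace_ne_bot_mem_spectrum ht)) w
  calc _ ≤ C * l ^ r * ‖w‖ := this
    _ = C * ‖w‖ * l ^ r := by ring

/-- Finite-sample risk bound of the estimator, uniform in `n` and `l > 0`. -/
theorem exists_risk_le [IsProbabilityMeasure ρ] [TopologicalSpace.SeparableSpace H] {c : ℝ}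
    (hA : ∀ f : H, (A f : X → ℝ) =ᵐ[ρ.fst] fun x => inner ℝ f (φ x))
    (hc : ∀ (x : X) (f : H), |inner ℝ f (φ x)| ≤ c * ‖f‖)
    {fdag : H} {σ : ℝ} (hmodel : IsSamplingModel ρ (A fdag) σ)
    {s : ℝ → ℝ → ℝ} {q : ℝ} (hs : IsFilterFamily (normalOp A) s q)
    {r R : ℝ} (hr : 0 < r) (hrq : r ≤ q) (hsource : fdag ∈ sourceSet (normalOp A) r R)
    {ev : ℕ → ℝ} (hev : IsEigenvalueList (normalOp A) ev)
    {d b : ℝ} (hd : 0 < d) (hb : 1 < b) (hdecay : ∀ j : ℕ, ev j ≤ d / ((j : ℝ) + 1) ^ b) :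
    ∃ V C : ℝ, ∀ l > 0, ∀ n : ℕ,
      Integrable (fun z : Fin n → X × ℝ => ‖estimator (normalOp A) s φ l z - fdag‖ ^ 2)
        (Measure.pi fun _ : Fin n => ρ) ∧
      (n ≠ 0 → ∫ z : Fin n → X × ℝ, ‖estimator (normalOp A) s φ l z - fdag‖ ^ 2
        ∂(Measure.pi fun _ : Fin n => ρ) ≤ V * (1 / n * l ^ (-(1 + 1 / b))) + C * l ^ (2 * r)) := by
  obtain ⟨K, hK0, hK⟩ := exists_lintegral_filter_le hA hs hev hd hb hdecay
  obtain ⟨C, hC0, hC⟩ := exists_norm_residual_le hs hr hrq hsource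
  obtain ⟨E, hE, hEb⟩ := hs.exists_abs_le
  have hφ := aestronglyMeasurable_feature hA
  set L := σ ^ 2 + (c * ‖fdag‖) ^ 2 with hLdef
  have hL0 : 0 ≤ L := by positivity
  have hL : ∀ᵐ x ∂ρ.fst, σ ^ 2 + A fdag x ^ 2 ≤ L := by
    filter_upwards [hA fdag] with x hx
    rw [hx, hLdef]
    gcongr 1
    exact sq_le_sq.2 ((hc x fdag).trans (le_abs_self _))
  -- Test the evaluation bound on `f = φ x`.
  have hφc : ∀ x, ‖φ x‖ ≤ |c| := by
    intro x
    have h1 := hc x (φ x)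
    rw [real_inner_self_eq_norm_sq, abs_of_nonneg (sq_nonneg _)] at h1
    by_contra! h2
    nlinarith [le_abs_self c, abs_nonneg c]
  have hY2 : MemLp (fun z : X × ℝ => z.2 • φ z.1) 2 ρ := by
    refine memLp_two_of_lintegral_lt_top (aestronglyMeasurable_smul_fst hφ)
      ((hmodel.lintegral_enorm_sq_smul_le hL hφ).trans_lt ?_)
    refine ENNReal.mul_lt_top ENNReal.ofReal_lt_top ?_
    refine (lintegral_mono (g := fun _ => ENNReal.ofReal (|c| ^ 2)) fun x => ?_).trans_lt ?_
    · rw [enorm_sq_eq_ofReal]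
      exact ENNReal.ofReal_le_ofReal (by gcongr; exact hφc x)
    · simp
  refine ⟨2 * (L * K), 2 * C ^ 2, fun l hl n => ?_⟩
  obtain ⟨S, hS⟩ := exists_clm_spectralFun (T := normalOp A) isSymmetric_normalOp (h := s l)
    (M := E / l) (hEb l hl)
  have hest : ∀ z : Fin n → X × ℝ, estimator (normalOp A) s φ l z
      = (1 / (n : ℝ)) • ∑ j, S ((z j).2 • φ (z j).1) := by
    intro z
    rw [estimator, ← hS, sampleAdjoint, map_smul, map_sum]
  simp_rw [hest]
  have hZ : MemLp (fun z : X × ℝ => S (z.2 • φ z.1)) 2 ρ := S.comp_memLp' hY2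
  have hmem := memLp_mean_sub hZ n fdag
  refine ⟨(memLp_two_iff_integrable_sq_norm hmem.1).1 hmem, fun hn => ?_⟩
  have hV : ∫⁻ z, ‖S (z.2 • φ z.1)‖ₑ ^ 2 ∂ρ
      ≤ ENNReal.ofReal (L * (K * l ^ (-(1 + 1 / b)))) := by
    simp_rw [map_smul]
    refine (hmodel.lintegral_enorm_sq_smul_le hL
      (S.continuous.comp_aestronglyMeasurable hφ)).trans ?_
    rw [ENNReal.ofReal_mul hL0]
    gcongr
    simp_rw [hS]
    exact hK l hl
  have hmean : ∫ z, S (z.2 • φ z.1) ∂ρ = spectralFun (s l) (normalOp A) (normalOp A fdag) := by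
    rw [S.integral_comp_comm (hY2.integrable one_le_two),
      integral_smul_feature hA hmodel (hY2.integrable one_le_two), hS]
  have hrisk := integral_norm_sq_mean_sub_le hZ hn (by positivity) hV fdag
  rw [hmean] at hrisk
  calc _ ≤ _ := hrisk
    _ ≤ 2 * (1 / n * (L * (K * l ^ (-(1 + 1 / b))))) + 2 * (C * l ^ r) ^ 2 := by
        gcongr
        exact hC l hl
    _ = _ := by
        rw [mul_pow, mul_comm 2 r, Real.rpow_mul hl.le, Real.rpow_ofNat]
        ring

end Rate

/-! ### Balancing variance against bias -/

section Asymptotic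

/-- The balancing choice of the parameter equates the orders of variance and squared bias. -/
theorem isBigO_balanced {r b V C : ℝ} (hr : 0 < r) (hb : 1 < b) {lam : ℕ → ℝ}
    (hlam_pos : ∀ n, 0 < lam n)
    (hlam : lam =Θ[atTop] fun n : ℕ => (1 / (n : ℝ)) ^ (1 / (2 * r + 1 + 1 / b))) :
    (fun n : ℕ => V * (1 / (n : ℝ) * lam n ^ (-(1 + 1 / b))) + C * lam n ^ (2 * r))
      =O[atTop] fun n : ℕ => (1 / (n : ℝ)) ^ (2 * r / (2 * r + 1 + 1 / b)) := by
  have hb0 : 0 < b := by linarith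
  have hκ : 0 < 2 * r + 1 + 1 / b := by positivity
  have hpow : ∀ p : ℝ, (fun n => lam n ^ p) =O[atTop]
      fun n : ℕ => (1 / (n : ℝ)) ^ (p / (2 * r + 1 + 1 / b)) := by
    intro p
    have h1 := (hlam.rpow (r := p) (Eventually.of_forall fun n => (hlam_pos n).le)
      (Eventually.of_forall fun n => by positivity)).isBigO
    refine h1.congr_right fun n => ?_
    rw [← Real.rpow_mul (by positivity)]
    congr 1
    ring
  refine IsBigO.add (IsBigO.const_mul_left ?_ V) ((hpow (2 * r)).const_mul_left C)
  refine ((isBigO_refl (fun n : ℕ => 1 / (n : ℝ)) atTop).mul (hpow (-(1 + 1 / b)))).congr'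
    EventuallyEq.rfl ?_
  -- Adding exponents needs a positive base, hence `n > 0`; with `κ = 2r + 1 + 1/b`, `1 - (1 +
  -- 1/b)/κ = 2r/κ`.
  filter_upwards [eventually_gt_atTop 0] with n hn
  have hn' : 0 < 1 / (n : ℝ) := by positivity
  nth_rewrite 1 [← Real.rpow_one (1 / (n : ℝ))]
  rw [← Real.rpow_add hn']
  congr 1
  field_simp
  ring

end Asymptotic

end SpectralRate

theorem mainTheorem10
    {X : Type*} [MeasurableSpace X]
    {H : Type*} [NormedAddCommGroup H] [InnerProductSpace ℝ H] [CompleteSpace H]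
    [TopologicalSpace.SeparableSpace H]
    -- the law of one observation `(X, Y)`; its first marginal `ρ.fst` is `ν`
    (ρ : Measure (X × ℝ)) [IsProbabilityMeasure ρ]
    -- the operator `A : H → L²(X, ν)`, `(A f)(x) = ⟨f, φ_x⟩`, with bounded point evaluations
    (A : H →L[ℝ] Lp ℝ 2 ρ.fst) (φ : X → H) (c : ℝ)
    (hA : ∀ f : H, (A f : X → ℝ) =ᵐ[ρ.fst] fun x => inner ℝ f (φ x))
    (hc : ∀ (x : X) (f : H), |inner ℝ f (φ x)| ≤ c * ‖f‖)
    -- the sampling model with regression function `A f†`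
    (fdag : H) (σ : ℝ) (hmodel : SpectralRate.IsSamplingModel ρ (A fdag) σ)
    -- the filter functions and their qualification
    (s : ℝ → ℝ → ℝ) (q : ℝ) (hs : SpectralRate.IsFilterFamily (SpectralRate.normalOp A) s q)
    -- the source condition
    (r R : ℝ) (hr : 0 < r) (hrq : r ≤ q) (hR : 0 < R)
    (hsource : fdag ∈ SpectralRate.sourceSet (SpectralRate.normalOp A) r R)
    -- the eigenvalue decay; `ev j` is the eigenvalue number `j + 1`
    (ev : ℕ → ℝ) (hev : SpectralRate.IsEigenvalueList (SpectralRate.normalOp A) ev)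
    (d b : ℝ) (hd : 0 < d) (hb : 1 < b) (hdecay : ∀ j : ℕ, ev j ≤ d / ((j : ℝ) + 1) ^ b)
    -- the choice of the regularization parameter
    (lam : ℕ → ℝ) (hlam_pos : ∀ n, 0 < lam n)
    (hlam : lam =Θ[atTop] fun n : ℕ => (1 / (n : ℝ)) ^ (1 / (2 * r + 1 + 1 / b))) :
    (∀ n : ℕ, Integrable
      (fun z : Fin n → X × ℝ =>
        ‖SpectralRate.estimator (SpectralRate.normalOp A) s φ (lam n) z - fdag‖ ^ 2)
      (Measure.pi fun _ : Fin n => ρ)) ∧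
    (fun n : ℕ => ∫ z : Fin n → X × ℝ,
        ‖SpectralRate.estimator (SpectralRate.normalOp A) s φ (lam n) z - fdag‖ ^ 2
          ∂(Measure.pi fun _ : Fin n => ρ))
      =O[atTop] fun n : ℕ => (1 / (n : ℝ)) ^ (2 * r / (2 * r + 1 + 1 / b)) := by
  obtain ⟨V, C, h⟩ := SpectralRate.exists_risk_le hA hc hmodel hs hr hrq hsource hev hd hb hdecay
  refine ⟨fun n => (h (lam n) (hlam_pos n) n).1, ?_⟩
  refine IsBigO.trans (IsBigO.of_bound' ?_)
    (SpectralRate.isBigO_balanced (V := V) (C := C) hr hb hlam_pos hlam)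
  filter_upwards [eventually_ne_atTop 0] with n hn
  rw [Real.norm_of_nonneg (integral_nonneg fun _ => sq_nonneg _)]
  exact ((h (lam n) (hlam_pos n) n).2 hn).trans (Real.le_norm_self _)
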